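/- Let $k$ be a field and let $A=k[x^{(1)}_1,x^{(2)}_1,x^{(2)}_2,\dots,x^{(n)}_1,\dots,x^{(n)}_n,\dots]$ be the polynomial ring over $k$ in the infinitely many variables $x^{(n)}_i$ $(n\ge 1,\ 1\le i\le n)$. For every integer $n\ge 1$ let $\mathfrak m_nA$ be the ideal of $A$ generated by $x^{(n)}_1,\dots,x^{(n)}_n$, which is a prime ideal. Put $S:=A\setminus\bigcup_{n\ge 1}\mathfrak m_nA$, which is a multiplicative subset of $A$, and $B:=S^{-1}A$. Then $B$ is a regular ring, i.e. $B$ is noetherian and the local ring $B_{\mathfrak p}$ is regular for every prime ideal $\mathfrak p$ of $B$. In particular, $B$ is universally catenary, i.e. $B$ is noetherian and every finitely generated (commutative) $B$-algebra $C$ is catenary: for any prime ideals $\mathfrak p\subseteq\mathfrak q$ of $C$, the lengths of the chains of prime ideals from $\mathfrak p$ to $\mathfrak q$ are bounded and all maximal such chains have the same length. -/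

import Mathlib

universe u

/-- A commutative ring is catenary if, for all primes `p ⊆ q`, the lengths of the finite chains of
primes from `p` to `q` are bounded, and all maximal (i.e. saturated) chains of primes from `p` to
`q` have the same length. -/
def IsCatenaryRing (R : Type u) [CommRing R] : Prop :=
  ∀ p q : PrimeSpectrum R, p ≤ q → ∃ n : ℕ,
    (∀ s : LTSeries (PrimeSpectrum R), s.head = p → s.last = q → s.length ≤ n) ∧
    (∀ s : RelSeries {(a, b) : PrimeSpectrum R × PrimeSpectrum R | a ⋖ b},
      s.head = p → s.last = q → s.length = n)

/-- A noetherian ring is universally catenary if every finitely generated algebra over it is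
catenary. (Every finitely generated `R`-algebra is isomorphic to a quotient of some
`R[y₁, …, yₘ]`, so it is enough to consider algebras in the universe of `R`.) -/
structure IsUniversallyCatenaryRing (R : Type u) [CommRing R] : Prop where
  isNoetherianRing : IsNoetherianRing R
  isCatenaryRing : ∀ (C : Type u) [CommRing C] [Algebra R C],
    Algebra.FiniteType R C → IsCatenaryRing C

namespace NagataExample

/-- The index set of the variables `x⁽ⁿ⁾ᵢ`: for each integer `n ≥ 1` there are `n` of them. -/
abbrev Index : Type := Σ n : ℕ+, Fin (n : ℕ)

/-- The polynomial ring `A = k[x⁽¹⁾₁, x⁽²⁾₁, x⁽²⁾₂, …, x⁽ⁿ⁾₁, …, x⁽ⁿ⁾ₙ, …]`. -/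
abbrev A (k : Type u) [Field k] : Type u := MvPolynomial Index k

/-- The ideal `𝔪ₙ A` of `A`, generated by `x⁽ⁿ⁾₁, …, x⁽ⁿ⁾ₙ`. -/
noncomputable def mA (k : Type u) [Field k] (n : ℕ+) : Ideal (A k) :=
  Ideal.span (Set.range fun i : Fin (n : ℕ) => (MvPolynomial.X ⟨n, i⟩ : A k))

theorem mA_isPrime (k : Type u) [Field k] (n : ℕ+) : (mA k n).IsPrime := by
  classical
  let φ : A k →ₐ[k] A k :=
    MvPolynomial.aeval fun j : Index => if j.1 = n then 0 else MvPolynomial.X j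
  have key : ∀ f : A k, f - φ f ∈ mA k n := by
    intro f
    rw [← Ideal.Quotient.eq]
    have h : (Ideal.Quotient.mkₐ k (mA k n)) = (Ideal.Quotient.mkₐ k (mA k n)).comp φ := by
      ext ⟨m, i⟩
      by_cases hm : m = n
      · subst hm
        simp only [φ, AlgHom.comp_apply, MvPolynomial.aeval_X, if_true, map_zero]
        exact Ideal.Quotient.eq_zero_iff_mem.2 (Ideal.subset_span ⟨i, rfl⟩)
      · simp [φ, hm]
    exact DFunLike.congr_fun h f
  have hker : mA k n = RingHom.ker φ.toRingHom := by
    apply le_antisymm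
    · refine Ideal.span_le.2 ?_
      rintro _ ⟨i, rfl⟩
      simp [φ, RingHom.mem_ker]
    · intro f hf
      have h0 : φ f = 0 := hf
      simpa [h0] using key f
  rw [hker]
  exact RingHom.ker_isPrime _

/-- The multiplicative subset `S = A ∖ ⋃ₙ 𝔪ₙ A = ⋂ₙ (A ∖ 𝔪ₙ A)`. -/
def S (k : Type u) [Field k] : Submonoid (A k) where
  carrier := {f | ∀ n : ℕ+, f ∉ mA k n}
  one_mem' n := (Ideal.ne_top_iff_one _).1 (mA_isPrime k n).ne_top
  mul_mem' hf hg n h := ((mA_isPrime k n).mem_or_mem h).elim (hf n) (hg n)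

/-- Nagata's ring `B = S⁻¹ A`. -/
abbrev B (k : Type u) [Field k] : Type u := Localization (S k)

end NagataExample

/-! A nonzero polynomial lies in only finitely many `𝔪ₙ A`, and this yields prime avoidance for the
infinite family, so every prime of `B` contracts into some `𝔪ₙ A`. There all nonzero polynomials in
the variables outside block `n` are inverted, so each local ring of `B` is a local ring of a
polynomial ring in finitely many variables over a field `K`, hence noetherian and regular. Nagata's
criterion then makes `B` noetherian.

For catenarity, a local ring of a finitely generated `B`-algebra is essentially of finite type over
such a `K`. On the spectrum of a finitely generated `K`-algebra, `p ↦ dim R/p` drops by exactly one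
along covers, by Noether normalization and going down. Such a function survives localization and
computes the length of saturated chains. -/

/-! ### Corank functions and catenarity -/

/-- A corank function on the prime spectrum: a strictly antitone `ℕ`-valued function that drops by
exactly one along covering relations. -/
def HasCorank (R : Type*) [CommRing R] : Prop :=
  ∃ d : PrimeSpectrum R → ℕ, StrictAnti d ∧ ∀ p q : PrimeSpectrum R, p ⋖ q → d p = d q + 1

/-- A chain ending at `q` lives in the spectrum of the localization at `q`, where the corank drops
by at least one per step, and by exactly one per step if the chain is saturated. -/
theorem isCatenaryRing_of_hasCorank_localization {R : Type u} [CommRing R]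
    (H : ∀ (q : Ideal R) [q.IsPrime], HasCorank (Localization.AtPrime q)) : IsCatenaryRing R := by
  intro p q _
  obtain ⟨d, hd, hd1⟩ := H q.asIdeal
  let e := IsLocalization.AtPrime.primeSpectrumOrderIso (Localization.AtPrime q.asIdeal) q.asIdeal
  classical
  let D : PrimeSpectrum R → ℕ := fun x =>
    if h : x ≤ q then d (e.symm ⟨x, h⟩) else 0
  have hD : ∀ x y, x < y → y ≤ q → D y + 1 ≤ D x := by
    intro x y hxy hyq
    have hxq := hxy.le.trans hyq
    simp only [D, dif_pos hyq, dif_pos hxq]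
    exact hd (e.symm.strictMono (show (⟨x, hxq⟩ : Set.Iic q) < ⟨y, hyq⟩ from hxy))
  have hD1 : ∀ x y, x ⋖ y → y ≤ q → D x = D y + 1 := by
    intro x y hxy hyq
    have hxq := hxy.le.trans hyq
    simp only [D, dif_pos hyq, dif_pos hxq]
    refine hd1 _ _ ((apply_covBy_apply_iff e.symm).2 ⟨hxy.lt, fun c h1 h2 => ?_⟩)
    exact hxy.2 (c := c.1) h1 h2
  refine ⟨D p - D q, fun s hp hq => ?_, fun s hp hq => ?_⟩
  · have hle : ∀ i, s i ≤ q := fun i => hq ▸ s.monotone (Fin.le_last i)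
    have key : ∀ i : Fin (s.length + 1), D (s i) + i ≤ D p := by
      intro i
      induction i using Fin.induction with
      | zero => rw [← hp]; rfl
      | succ i ih =>
        have := hD _ _ (s.step i) (hle _)
        simp only [Fin.val_castSucc, Fin.val_succ] at *
        omega
    have := key (Fin.last _)
    have h2 : s (Fin.last _) = q := hq
    rw [h2, Fin.val_last] at this
    omega
  · have hle : ∀ i, s i ≤ q := by
      intro i
      induction i using Fin.reverseInduction with
      | last => exact hq.le
      | cast i ih => exact (s.step i : s i.castSucc ⋖ s i.succ).le.trans ih
    have key : ∀ i : Fin (s.length + 1), D (s i) + i = D p := by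
      intro i
      induction i using Fin.induction with
      | zero => rw [← hp]; rfl
      | succ i ih =>
        have := hD1 _ _ (s.step i) (hle _)
        simp only [Fin.val_castSucc, Fin.val_succ] at *
        omega
    have := key (Fin.last _)
    have h2 : s (Fin.last _) = q := hq
    rw [h2, Fin.val_last] at this
    omega

/-- The primes disjoint from `M` are closed under passing to smaller primes, so covers among them
are covers in the whole spectrum. -/
theorem HasCorank.of_isLocalization {R : Type*} [CommRing R] (M : Submonoid R) (S : Type*)
    [CommRing S] [Algebra R S] [IsLocalization M S] (H : HasCorank R) : HasCorank S := by
  obtain ⟨d, hd, hd1⟩ := H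
  let e := IsLocalization.primeSpectrumOrderIso M S
  refine ⟨fun p => d (e p).1, fun p q hpq => hd (e.strictMono hpq), fun p q hpq => hd1 _ _ ?_⟩
  have h := (apply_covBy_apply_iff e).2 hpq
  refine ⟨h.lt, fun c h1 h2 => ?_⟩
  exact h.2 (c := ⟨c, Set.disjoint_of_subset_right (SetLike.coe_subset_coe.2 h2.le) (e q).2⟩) h1 h2

/-! ### Dimension theory of finitely generated algebras over a field -/

/-- Integral extensions preserve the Krull dimension. -/
theorem ringKrullDim_eq_of_isIntegral (R S : Type*) [CommRing R] [CommRing S] [Algebra R S]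
    [FaithfulSMul R S] [Algebra.IsIntegral R S] : ringKrullDim S = ringKrullDim R := by
  apply le_antisymm
  · exact Order.krullDim_le_of_strictMono (PrimeSpectrum.comap (algebraMap R S))
      fun p q hpq => Ideal.IsIntegral.comap_lt_comap hpq
  · refine iSup_le fun l => ?_
    obtain ⟨⟨P, hP, hPl⟩⟩ := Ideal.nonempty_primesOver (S := S) l.head.asIdeal
    obtain ⟨L, hL, -⟩ := Ideal.exists_ltSeries_of_hasGoingUp l P
    rw [← hL]
    exact Order.LTSeries.length_le_krullDim L

theorem MvPolynomial.height_eq_of_isMaximal (K : Type*) [Field K] (n : ℕ)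
    (m : Ideal (MvPolynomial (Fin n) K)) [m.IsMaximal] : m.height = n := by
  induction n with
  | zero =>
    apply le_antisymm
    · have h := Ideal.height_le_ringKrullDim_of_isPrime (I := m)
      rw [MvPolynomial.ringKrullDim_of_isNoetherianRing, ringKrullDim_eq_zero_of_field] at h
      simpa using h
    · simp
  | succ n ih =>
    let e := (MvPolynomial.finSuccEquiv K n).toRingEquiv
    have hmax : (m.map e).IsMaximal := Ideal.map_isMaximal_of_equiv e
    have h1 : (m.map e).height = m.height := RingEquiv.height_map e m
    have : (m.map e).LiesOver ((m.map e).under (MvPolynomial (Fin n) K)) := ⟨rfl⟩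
    have := Polynomial.height_eq_height_add_one
      ((m.map e).under (MvPolynomial (Fin n) K)) (m.map e)
    have : ((m.map e).under (MvPolynomial (Fin n) K)).IsMaximal :=
      Polynomial.isMaximal_comap_C_of_isJacobsonRing _
    rw [← h1, ‹(m.map e).height = _›, ih]
    simp

/-- After Noether normalization, `q` contracts to a prime containing some prime element `f`. Going
down gives a nonzero prime below `q` over `(f)`, which is `q` by minimality. So `R ⧸ q` is integral
over a hypersurface ring. -/
theorem ringKrullDim_le_ringKrullDim_quotient_add_one_of_bot_covBy (K R : Type*) [Field K]
    [CommRing R] [IsDomain R] [Algebra K R] [Algebra.FiniteType K R] (q : Ideal R) [q.IsPrime]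
    (hq0 : q ≠ ⊥) (hq : ∀ p : Ideal R, p.IsPrime → p < q → p = ⊥) :
    ringKrullDim R ≤ ringKrullDim (R ⧸ q) + 1 := by
  obtain ⟨s, g, hginj, hgint⟩ := exists_integral_inj_algHom_of_fg K R
  algebraize [g.toRingHom]
  have : FaithfulSMul (MvPolynomial (Fin s) K) R :=
    (faithfulSMul_iff_algebraMap_injective _ _).2 hginj
  obtain ⟨f, hfq, hf⟩ := Ideal.IsPrime.exists_mem_prime_of_ne_bot
    (I := q.under (MvPolynomial (Fin s) K)) inferInstance (Ideal.IsIntegral.comap_ne_bot _ hq0)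
  have hfp : (Ideal.span {f}).IsPrime := (Ideal.span_singleton_prime hf.ne_zero).2 hf
  obtain ⟨P, hPq, hP, hPf⟩ := Ideal.exists_ideal_le_liesOver_of_le (p := Ideal.span {f})
    (q := q.under (MvPolynomial (Fin s) K)) q ((Ideal.span_singleton_le_iff_mem _).2 hfq)
  have hPq' : P = q := by
    refine hPq.eq_of_not_lt fun hlt => ?_
    have h0 := hPf.over
    rw [hq P hP hlt] at h0
    have : f ∈ (⊥ : Ideal R).under (MvPolynomial (Fin s) K) :=
      h0 ▸ Ideal.mem_span_singleton_self f
    have : algebraMap (MvPolynomial (Fin s) K) R f = 0 := this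
    exact hf.ne_zero ((map_eq_zero_iff _ hginj).1 this)
  subst hPq'
  -- A maximal ideal has full height `s`, so dividing by one of its elements lowers the dimension by
  -- at most one.
  obtain ⟨m, hm, hfm⟩ := Ideal.exists_le_maximal _ hfp.ne_top
  have h1 := Ideal.height_le_ringKrullDim_quotient_add_one (p := m) (r := f)
    (hfm (Ideal.mem_span_singleton_self f))
  rw [MvPolynomial.height_eq_of_isMaximal] at h1
  rw [ringKrullDim_eq_of_isIntegral (MvPolynomial (Fin s) K) R,
    ringKrullDim_eq_of_isIntegral (MvPolynomial (Fin s) K ⧸ Ideal.span {f}) (R ⧸ P),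
    MvPolynomial.ringKrullDim_of_isNoetherianRing, ringKrullDim_eq_zero_of_field]
  simpa using h1

/-- The corank of `p` is `dim R/p`. It drops strictly since a nonzero element of `q/p` is a
nonzerodivisor, and by at most one along covers by the previous bound. -/
theorem HasCorank.of_finiteType (K R : Type*) [Field K] [CommRing R] [Algebra K R]
    [Algebra.FiniteType K R] : HasCorank R := by
  have hfin : ∀ p : PrimeSpectrum R, ∃ n : ℕ, ringKrullDim (R ⧸ p.asIdeal) = n := by
    intro p
    obtain ⟨s, g, hginj, hgint⟩ := exists_integral_inj_algHom_of_fg K (R ⧸ p.asIdeal)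
    algebraize [g.toRingHom]
    have : FaithfulSMul (MvPolynomial (Fin s) K) (R ⧸ p.asIdeal) :=
      (faithfulSMul_iff_algebraMap_injective _ _).2 hginj
    refine ⟨s, ?_⟩
    rw [ringKrullDim_eq_of_isIntegral (MvPolynomial (Fin s) K),
      MvPolynomial.ringKrullDim_of_isNoetherianRing, ringKrullDim_eq_zero_of_field]
    simp
  choose d hd using hfin
  have hquot : ∀ p q : PrimeSpectrum R, p ≤ q →
      ringKrullDim ((R ⧸ p.asIdeal) ⧸ q.asIdeal.map (Ideal.Quotient.mk p.asIdeal)) = d q :=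
    fun p q hpq => by
      rw [ringKrullDim_eq_of_ringEquiv (DoubleQuot.quotQuotEquivQuotOfLE hpq), hd]
  have hprime : ∀ p q : PrimeSpectrum R, p ≤ q →
      (q.asIdeal.map (Ideal.Quotient.mk p.asIdeal)).IsPrime :=
    fun p q hpq => Ideal.isPrime_map_quotientMk_of_isPrime hpq
  have hne : ∀ p q : PrimeSpectrum R, p < q →
      q.asIdeal.map (Ideal.Quotient.mk p.asIdeal) ≠ ⊥ := fun p q hpq h => by
    rw [Ideal.map_eq_bot_iff_le_ker, Ideal.mk_ker] at h
    exact hpq.not_ge h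
  have hanti : StrictAnti d := by
    intro p q hpq
    obtain ⟨x, hx, hx0⟩ := Submodule.exists_mem_ne_zero_of_ne_bot (hne p q hpq)
    have h := ringKrullDim_quotient_succ_le_of_nonZeroDivisor (mem_nonZeroDivisors_of_ne_zero hx0)
    have h2 : ringKrullDim ((R ⧸ p.asIdeal) ⧸ q.asIdeal.map (Ideal.Quotient.mk p.asIdeal)) ≤
        ringKrullDim ((R ⧸ p.asIdeal) ⧸ Ideal.span {x}) :=
      ringKrullDim_le_of_surjective
        (Ideal.Quotient.factor ((Ideal.span_singleton_le_iff_mem _).2 hx))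
        (Ideal.Quotient.factor_surjective _)
    rw [hquot p q hpq.le] at h2
    have h3 := (add_le_add_left h2 1).trans h
    rw [hd] at h3
    exact_mod_cast h3
  refine ⟨d, hanti, fun p q hpq => le_antisymm ?_ (hanti hpq.lt)⟩
  have := hprime p q hpq.le
  have h := ringKrullDim_le_ringKrullDim_quotient_add_one_of_bot_covBy K (R ⧸ p.asIdeal)
    (q.asIdeal.map (Ideal.Quotient.mk p.asIdeal)) (hne p q hpq.lt) fun P hP hlt => by
      let P' : PrimeSpectrum R := ⟨P.comap (Ideal.Quotient.mk p.asIdeal), inferInstance⟩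
      have hmap : P'.asIdeal.map (Ideal.Quotient.mk p.asIdeal) = P :=
        Ideal.map_comap_of_surjective _ Ideal.Quotient.mk_surjective P
      have hpP : p ≤ P' := by
        have := Ideal.ker_le_comap (K := P) (Ideal.Quotient.mk p.asIdeal)
        rwa [Ideal.mk_ker] at this
      have hPq : P' < q := by
        have h1 : P'.asIdeal ≤ q.asIdeal := by
          have := Ideal.comap_mono (f := Ideal.Quotient.mk p.asIdeal) hlt.le
          rwa [Ideal.comap_map_of_surjective' _ Ideal.Quotient.mk_surjective, Ideal.mk_ker,
            sup_eq_left.2 hpq.le] at this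
        refine lt_of_le_of_ne h1 ?_
        rintro rfl
        exact hlt.ne hmap.symm
      by_contra hPbot
      have : p ≠ P' := by
        intro h
        apply hPbot
        rw [← hmap, ← h]
        exact Ideal.map_quotient_self _
      exact hpq.2 (lt_of_le_of_ne hpP this) hPq
  rw [hquot p q hpq.le, hd] at h
  exact_mod_cast h

theorem HasCorank.of_essFiniteType (K R : Type*) [Field K] [CommRing R] [Algebra K R]
    [Algebra.EssFiniteType K R] : HasCorank R :=
  (HasCorank.of_finiteType K (Algebra.EssFiniteType.subalgebra K R)).of_isLocalization
    (Algebra.EssFiniteType.submonoid K R) R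

/-! ### Nagata's noetherianity criterion -/

theorem Ideal.exists_fg_le_forall_exists_mul_mem {R : Type*} [CommRing R] (I M : Ideal R)
    [M.IsPrime] [IsNoetherianRing (Localization.AtPrime M)] :
    ∃ J : Ideal R, J.FG ∧ J ≤ I ∧ ∀ x ∈ I, ∃ s ∉ M, s * x ∈ J := by
  classical
  have hfg : (Ideal.span (algebraMap R (Localization.AtPrime M) '' I)).FG :=
    IsNoetherian.noetherian _
  obtain ⟨T, hT, hspan⟩ := (Submodule.fg_span_iff_fg_span_finset_subset _).1 hfg
  obtain ⟨U, hUI, rfl⟩ := Finset.subset_set_image_iff.1 hT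
  refine ⟨Ideal.span U, ⟨U, rfl⟩, Ideal.span_le.2 hUI, fun x hx => ?_⟩
  have h1 : algebraMap R (Localization.AtPrime M) x ∈
      (Ideal.span (U : Set R)).map (algebraMap R (Localization.AtPrime M)) := by
    rw [Ideal.map_span, ← Finset.coe_image, Ideal.span, ← hspan]
    exact Ideal.subset_span ⟨x, hx, rfl⟩
  exact (IsLocalization.algebraMap_mem_map_algebraMap_iff M.primeCompl _ _ _).1 h1

/-- Nagata's criterion: a ring is noetherian if its localizations at maximal ideals are, and every
nonzero element lies in only finitely many maximal ideals. -/
theorem isNoetherianRing_of_finite_maximal_of_localization {R : Type*} [CommRing R]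
    (hfin : ∀ f : R, f ≠ 0 → {M : Ideal R | M.IsMaximal ∧ f ∈ M}.Finite)
    (hloc : ∀ (M : Ideal R) [M.IsMaximal], IsNoetherianRing (Localization.AtPrime M)) :
    IsNoetherianRing R := by
  rw [isNoetherianRing_iff_ideal_fg]
  intro I
  by_cases hI : I = ⊥
  · exact hI ▸ Submodule.fg_bot
  obtain ⟨f, hf, hf0⟩ := Submodule.exists_mem_ne_zero_of_ne_bot hI
  have hM : ∀ M : {M : Ideal R | M.IsMaximal ∧ f ∈ M}, ∃ J : Ideal R, J.FG ∧ J ≤ I ∧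
      ∀ x ∈ I, ∃ s ∉ M.1, s * x ∈ J := by
    rintro ⟨M, hM, -⟩
    have := hloc M
    exact I.exists_fg_le_forall_exists_mul_mem M
  choose J hJfg hJI hJ using hM
  have := (hfin f hf0).to_subtype
  have hle : Ideal.span {f} ⊔ ⨆ M, J M ≤ I :=
    sup_le ((Ideal.span_singleton_le_iff_mem _).2 hf) (iSup_le hJI)
  suffices h : I ≤ Ideal.span {f} ⊔ ⨆ M, J M by
    rw [le_antisymm h hle]
    exact (Submodule.fg_span_singleton f).sup (Submodule.fg_iSup _ hJfg)
  intro x hx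
  -- No maximal ideal `M` contains this colon ideal: `f` itself is a witness if `f ∉ M`, and
  -- otherwise `J M` supplies one.
  have htop : (Ideal.span {f} ⊔ ⨆ M, J M).colon {x} = ⊤ := by
    by_contra hne
    obtain ⟨M, hM, hle⟩ := Ideal.exists_le_maximal _ hne
    by_cases hfM : f ∈ M
    · obtain ⟨s, hs, hsx⟩ := hJ ⟨M, hM, hfM⟩ x hx
      exact hs (hle (Submodule.mem_colon_singleton.2
        (le_sup_right (α := Ideal R) (le_iSup J ⟨M, hM, hfM⟩ hsx))))
    · refine hfM (hle (Submodule.mem_colon_singleton.2 ?_))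
      exact Ideal.mul_mem_right _ _ (le_sup_left (α := Ideal R) (Ideal.mem_span_singleton_self f))
  have := (Ideal.eq_top_iff_one _).1 htop
  simpa [Submodule.mem_colon_singleton] using this

/-! ### Prime avoidance for the ideals `𝔪ₙ A` -/

namespace NagataExample

variable (k : Type u) [Field k]

open Classical in
/-- The endomorphism of `A` that sends the variables of the `n`-th block to zero. -/
noncomputable def killBlock (n : ℕ+) : A k →ₐ[k] A k :=
  MvPolynomial.aeval fun j : Index => if j.1 = n then 0 else MvPolynomial.X j

variable {k}

theorem mem_mA_iff_killBlock {n : ℕ+} {f : A k} : f ∈ mA k n ↔ killBlock k n f = 0 := by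
  constructor
  · intro hf
    have : mA k n ≤ RingHom.ker (killBlock k n) := by
      refine Ideal.span_le.2 ?_
      rintro _ ⟨i, rfl⟩
      simp [RingHom.mem_ker, killBlock]
    exact this hf
  · intro hf
    have h : (Ideal.Quotient.mkₐ k (mA k n)) =
        (Ideal.Quotient.mkₐ k (mA k n)).comp (killBlock k n) := by
      ext ⟨m, i⟩
      by_cases hm : m = n
      · subst hm
        simp only [killBlock, AlgHom.comp_apply, MvPolynomial.aeval_X, if_true, map_zero]
        exact Ideal.Quotient.eq_zero_iff_mem.2 (Ideal.subset_span ⟨i, rfl⟩)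
      · simp [killBlock, hm]
    have h2 := DFunLike.congr_fun h f
    rw [AlgHom.comp_apply, hf, map_zero] at h2
    exact Ideal.Quotient.eq_zero_iff_mem.1 h2

theorem killBlock_comm (m n : ℕ+) (f : A k) :
    killBlock k m (killBlock k n f) = killBlock k n (killBlock k m f) := by
  have : (killBlock k m).comp (killBlock k n) = (killBlock k n).comp (killBlock k m) := by
    ext j : 1
    simp only [AlgHom.comp_apply, killBlock, MvPolynomial.aeval_X]
    split_ifs with h1 h2 h2 <;> simp only [MvPolynomial.aeval_X, map_zero, if_pos, *, if_false]
  exact DFunLike.congr_fun this f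

theorem killBlock_eq_self {n : ℕ+} {f : A k} (hf : ∀ j ∈ f.vars, j.1 ≠ n) :
    killBlock k n f = f := by
  conv_rhs => rw [← MvPolynomial.aeval_X_left_apply f]
  refine MvPolynomial.eval₂Hom_congr' rfl (fun j hj _ => ?_) rfl
  simp [hf j hj]

theorem finite_setOf_mem_mA {f : A k} (hf : f ≠ 0) : {n : ℕ+ | f ∈ mA k n}.Finite := by
  refine (f.vars.image Sigma.fst).finite_toSet.subset fun n hn => ?_
  by_contra h
  refine hf ?_
  rw [← killBlock_eq_self (n := n) (f := f), mem_mA_iff_killBlock.1 hn]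
  rintro j hj rfl
  exact h (by simpa using ⟨j.2, hj⟩)

/-- Prime avoidance for the infinite family of the ideals `𝔪ₙ A`. -/
theorem exists_le_mA_of_forall_exists_mem {I : Ideal (A k)} (hI : ∀ f ∈ I, ∃ n, f ∈ mA k n) :
    ∃ n, I ≤ mA k n := by
  by_contra! hne
  have hbot : I ≠ ⊥ := by
    rintro rfl
    exact hne 1 bot_le
  obtain ⟨f, hf, hf0⟩ := Submodule.exists_mem_ne_zero_of_ne_bot hbot
  have hfin := finite_setOf_mem_mA hf0
  -- Finite prime avoidance suffices here, as only finitely many `𝔪ₙ A` contain `f`.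
  obtain ⟨g, hg, hgn⟩ : ∃ g ∈ I, ∀ n, f ∈ mA k n → g ∉ mA k n := by
    by_contra! h
    obtain ⟨n, -, hn⟩ := (Ideal.subset_union_prime_finite hfin (f := mA k) 1 1
      fun n _ _ _ => mA_isPrime k n).1 fun g hg => by
        obtain ⟨n, h1, h2⟩ := h g hg
        exact Set.mem_biUnion h1 h2
    exact hne n hn
  classical
  obtain ⟨N, hN⟩ := Infinite.exists_notMem_finset ((f.vars ∪ g.vars).image Sigma.fst)
  have hNf : killBlock k N f = f := killBlock_eq_self fun j hj h =>
    hN (Finset.mem_image.2 ⟨j, Finset.mem_union_left _ hj, h⟩)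
  have hNg : killBlock k N g = g := killBlock_eq_self fun j hj h =>
    hN (Finset.mem_image.2 ⟨j, Finset.mem_union_right _ hj, h⟩)
  let v : Index := ⟨N, ⟨0, N.pos⟩⟩
  -- The variable `X v` occurs in neither `f` nor `g`. If `n = N`, killing block `N` gives `f = 0`;
  -- otherwise it separates the two summands, putting both `f` and `g` in `mA k n`.
  obtain ⟨n, hn⟩ := hI (f + MvPolynomial.X v * g) (I.add_mem hf (I.mul_mem_left _ hg))
  rw [mem_mA_iff_killBlock, map_add, map_mul] at hn
  have hv : killBlock k N (MvPolynomial.X v) = 0 := by simp [killBlock, v]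
  by_cases hnN : n = N
  · subst hnN
    rw [hv, zero_mul, add_zero, hNf] at hn
    exact hf0 hn
  · have hv' : killBlock k n (MvPolynomial.X v) = MvPolynomial.X v := by
      simp [killBlock, v, Ne.symm hnN]
    have h1 := congrArg (killBlock k N) hn
    rw [hv', map_add, map_mul, hv, zero_mul, add_zero, killBlock_comm, hNf, map_zero] at h1
    rw [hv', h1, zero_add] at hn
    exact hgn n (mem_mA_iff_killBlock.2 h1)
      (mem_mA_iff_killBlock.2 ((mul_eq_zero.1 hn).resolve_left (MvPolynomial.X_ne_zero v)))

end NagataExample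

/-! ### The local rings of `A` and `B` -/

/-- A polynomial ring is a polynomial ring in some of its variables over the polynomial ring in
the others. -/
theorem MvPolynomial.exists_algEquiv_subtype (R : Type*) {σ : Type*} [CommRing R] (p : σ → Prop) :
    ∃ e : MvPolynomial σ R ≃ₐ[R] MvPolynomial {j // p j} (MvPolynomial {j // ¬ p j} R),
      ∀ r, e (rename Subtype.val r) = C r := by
  classical
  refine ⟨(((sumAlgEquiv R _ _).symm).trans (renameEquiv R (Equiv.sumCompl p))).symm,
    fun r => ?_⟩
  have h : sumAlgEquiv R {j // p j} {j // ¬ p j} (rename Sum.inr r) = C r :=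
    DFunLike.congr_fun (sumAlgEquiv_comp_rename_inr R {j // p j} {j // ¬ p j}) r
  rw [AlgEquiv.symm_apply_eq, ← h, AlgEquiv.trans_apply, AlgEquiv.symm_apply_apply,
    renameEquiv_apply, rename_rename]
  rfl

attribute [local instance] MvPolynomial.algebraMvPolynomial in
-- Nonzero constants lie outside `P`, so inverting them first does not change the local ring at `P`.
theorem MvPolynomial.exists_ringEquiv_localization_fractionRing (R ι : Type*) [CommRing R]
    [IsDomain R] (P : Ideal (MvPolynomial ι R)) [P.IsPrime] (hP : P.comap C = ⊥) :
    ∃ (Q : Ideal (MvPolynomial ι (FractionRing R))) (_ : Q.IsPrime),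
      Nonempty (Localization.AtPrime P ≃+* Localization.AtPrime Q) := by
  let M := (nonZeroDivisors R).map (C (σ := ι))
  have : IsLocalization M (MvPolynomial ι (FractionRing R)) := MvPolynomial.isLocalization _ _
  have disj : Disjoint (M : Set (MvPolynomial ι R)) P := by
    rw [Set.disjoint_left]
    rintro _ ⟨r, hr, rfl⟩ hrP
    have : r ∈ P.comap C := hrP
    rw [hP] at this
    exact nonZeroDivisors.ne_zero hr this
  let Q := P.map (algebraMap (MvPolynomial ι R) (MvPolynomial ι (FractionRing R)))
  have hQ : Q.IsPrime := IsLocalization.isPrime_of_isPrime_disjoint M _ _ ‹_› disj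
  have : IsLocalization.AtPrime (Localization.AtPrime Q) P := by
    convert IsLocalization.isLocalization_isLocalization_atPrime_isLocalization M
      (Localization.AtPrime Q) Q
    exact (IsLocalization.under_map_of_isPrime_disjoint M _ ‹_› disj).symm
  exact ⟨Q, hQ, ⟨(IsLocalization.algEquiv P.primeCompl
    (Localization.AtPrime P) (Localization.AtPrime Q)).toRingEquiv⟩⟩

namespace NagataExample

variable {k : Type u} [Field k]

instance finite_block (n : ℕ+) : Finite {j : Index // j.1 = n} :=
  Finite.of_surjective (fun i : Fin (n : ℕ) => (⟨⟨n, i⟩, rfl⟩ : {j : Index // j.1 = n})) (by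
    rintro ⟨⟨m, i⟩, rfl⟩
    exact ⟨i, rfl⟩)

/-- The local rings of `A` at primes inside some `𝔪ₙ A` are local rings of polynomial rings in
finitely many variables over a field. -/
theorem exists_ringEquiv_localization_of_le_mA {n : ℕ+} (p : Ideal (A k)) [p.IsPrime]
    (hp : p ≤ mA k n) :
    ∃ (K : Type u) (_ : Field K) (Q : Ideal (MvPolynomial {j : Index // j.1 = n} K))
      (_ : Q.IsPrime), Nonempty (Localization.AtPrime p ≃+* Localization.AtPrime Q) := by
  let R := MvPolynomial {j : Index // ¬ j.1 = n} k
  obtain ⟨e, he⟩ := MvPolynomial.exists_algEquiv_subtype k fun j : Index => j.1 = n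
  have hkill : ∀ r : R, killBlock k n (MvPolynomial.rename Subtype.val r) =
      MvPolynomial.rename Subtype.val r := by
    intro r
    have : (killBlock k n).comp (MvPolynomial.rename Subtype.val) =
        MvPolynomial.rename (R := k) (Subtype.val : {j : Index // ¬ j.1 = n} → Index) := by
      ext j : 1
      simp [killBlock, j.2]
    exact DFunLike.congr_fun this r
  let P := p.comap e.toRingEquiv.symm
  -- A polynomial without variables from block `n` is fixed by `killBlock k n`, so it lies in `mA k
  -- n` only if it is zero.
  have hP : P.comap MvPolynomial.C = ⊥ := by
    rw [eq_bot_iff]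
    intro r hr
    have h1 : e.symm (MvPolynomial.C r) ∈ p := hr
    rw [← he, AlgEquiv.symm_apply_apply] at h1
    have h2 := mem_mA_iff_killBlock.1 (hp h1)
    rw [hkill] at h2
    exact (map_eq_zero_iff _ (MvPolynomial.rename_injective _ Subtype.val_injective)).1 h2
  obtain ⟨Q, hQ, ⟨e'⟩⟩ := MvPolynomial.exists_ringEquiv_localization_fractionRing _ _ P hP
  refine ⟨FractionRing R, inferInstance, Q, hQ, ⟨RingEquiv.trans ?_ e'⟩⟩
  exact (IsLocalization.ringEquivOfRingEquiv (Localization.AtPrime P) (Localization.AtPrime p)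
    e.toRingEquiv.symm (e.toRingEquiv.symm.map_primeCompl_comap_eq p)).symm

theorem exists_comap_le_mA (P : Ideal (B k)) [P.IsPrime] :
    ∃ n, P.comap (algebraMap (A k) (B k)) ≤ mA k n := by
  refine exists_le_mA_of_forall_exists_mem fun f hf => ?_
  by_contra! h
  exact Set.disjoint_left.1 ((IsLocalization.isPrime_iff_isPrime_disjoint (S k) (B k) P).1 ‹_›).2
    h hf

theorem exists_ringEquiv_localization_B (P : Ideal (B k)) [P.IsPrime] :
    ∃ (ι : Type) (_ : Finite ι) (K : Type u) (_ : Field K) (Q : Ideal (MvPolynomial ι K))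
      (_ : Q.IsPrime), Nonempty (Localization.AtPrime P ≃+* Localization.AtPrime Q) := by
  obtain ⟨n, hn⟩ := exists_comap_le_mA P
  obtain ⟨K, _, Q, hQ, ⟨e⟩⟩ := exists_ringEquiv_localization_of_le_mA _ hn
  have := IsLocalization.isLocalization_isLocalization_atPrime_isLocalization (S k)
    (Localization.AtPrime P) P
  exact ⟨_, inferInstance, K, inferInstance, Q, hQ, ⟨(IsLocalization.algEquiv
    (P.comap (algebraMap (A k) (B k))).primeCompl (Localization.AtPrime P)
    (Localization.AtPrime (P.comap (algebraMap (A k) (B k))))).toRingEquiv.trans e⟩⟩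

/-! ### Noetherianity, regularity and universal catenarity of `B` -/

instance isNoetherianRing_B : IsNoetherianRing (B k) := by
  refine isNoetherianRing_of_finite_maximal_of_localization (fun f hf => ?_) fun M _ => ?_
  · obtain ⟨⟨a, s⟩, has⟩ := IsLocalization.surj (S k) f
    have ha : a ≠ 0 := by
      rintro rfl
      rw [map_zero] at has
      exact hf ((IsLocalization.map_units (B k) s).mul_left_eq_zero.1 has)
    -- Every maximal ideal of `B` is the extension of some `mA k n`; if it contains `f`, then `mA k
    -- n` contains the numerator `a`.
    refine ((finite_setOf_mem_mA ha).image
      fun n => (mA k n).map (algebraMap (A k) (B k))).subset ?_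
    rintro M ⟨hM, hfM⟩
    obtain ⟨n, hn⟩ := exists_comap_le_mA M
    refine ⟨n, hn (show algebraMap (A k) (B k) a ∈ M from has ▸ M.mul_mem_right _ hfM), ?_⟩
    have hprime : ((mA k n).map (algebraMap (A k) (B k))).IsPrime :=
      IsLocalization.isPrime_of_isPrime_disjoint (S k) _ _ (mA_isPrime k n)
        (Set.disjoint_left.2 fun x hx => hx n)
    refine (hM.eq_of_le hprime.ne_top ?_).symm
    rw [← IsLocalization.map_under (S k) (B k) M]
    exact Ideal.map_mono hn
  · obtain ⟨ι, _, K, _, Q, hQ, ⟨e⟩⟩ := exists_ringEquiv_localization_B M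
    exact isNoetherianRing_of_ringEquiv _ e.symm

theorem isRegularRing_B : IsRegularRing (B k) := by
  refine isRegularRing_iff.2 fun P _ => ?_
  obtain ⟨ι, _, K, _, Q, hQ, ⟨e⟩⟩ := exists_ringEquiv_localization_B P
  exact IsRegularLocalRing.of_ringEquiv e.symm

theorem isUniversallyCatenaryRing_B : IsUniversallyCatenaryRing (B k) where
  isNoetherianRing := inferInstance
  isCatenaryRing C _ _ _ := by
    refine isCatenaryRing_of_hasCorank_localization fun q _ => ?_
    obtain ⟨P, _, _⟩ : ∃ P : Ideal (B k), P.IsPrime ∧ q.LiesOver P :=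
      ⟨q.under (B k), inferInstance, inferInstance⟩
    obtain ⟨ι, _, K, _, Q, hQ, ⟨e⟩⟩ := exists_ringEquiv_localization_B P
    let := Localization.AtPrime.algebraOfLiesOver P q
    have : Algebra.EssFiniteType (B k) (Localization.AtPrime q) := inferInstance
    have : IsScalarTower (B k) (Localization.AtPrime P) (Localization.AtPrime q) :=
      .of_algebraMap_eq fun x => (Localization.localRingHom_to_map P q _ Ideal.LiesOver.over x).symm
    have : Algebra.EssFiniteType (Localization.AtPrime P) (Localization.AtPrime q) :=
      .of_comp (B k) _ _
    -- The `K`-structures are transported along `e` so that `K → B_P → C_q` is a tower of maps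
    -- essentially of finite type.
    let := (e.symm.toRingHom.comp (algebraMap K _)).toAlgebra
    let := ((algebraMap (Localization.AtPrime P) (Localization.AtPrime q)).comp
      (algebraMap K (Localization.AtPrime P))).toAlgebra
    have : IsScalarTower K (Localization.AtPrime P) (Localization.AtPrime q) :=
      .of_algebraMap_eq' rfl
    have : Algebra.EssFiniteType K (Localization.AtPrime Q) := .comp K (MvPolynomial ι K) _
    have : Algebra.EssFiniteType K (Localization.AtPrime P) :=
      .of_surjective (AlgHom.mk e.symm.toRingHom fun _ => rfl) e.symm.surjective
    have : Algebra.EssFiniteType K (Localization.AtPrime q) := .comp K (Localization.AtPrime P) _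
    exact .of_essFiniteType K _

end NagataExample

theorem proposition3p8 (k : Type u) [Field k] :
    IsRegularRing (NagataExample.B k) ∧ IsUniversallyCatenaryRing (NagataExample.B k) :=
  ⟨NagataExample.isRegularRing_B, NagataExample.isUniversallyCatenaryRing_B⟩
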